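/- Let $\mathbb K$ be an arbitrary field and let $\mathcal S\subsetneq\mathbb N$ be a numerical semigroup, that is, a proper submonoid of $(\mathbb N,+)$ with finite complement. Let $A=\{a_1,\dots,a_m\}$ be its unique minimal generating set, and let $I_{\mathcal S}\subseteq\mathbb K[x_1,\dots,x_m]$ be its toric ideal, i.e. the ideal generated by all binomials $x^{u}-x^{v}$, $u,v\in\mathbb N^m$, with $\sum_i u_ia_i=\sum_i v_ia_i$. The universal Gröbner basis of an ideal is the union of its reduced Gröbner bases over all monomial orders, where polynomials that differ only by a nonzero scalar factor (here, by a sign) are identified. An ideal is called robust if its universal Gröbner basis is a minimal (with respect to inclusion) set of generators of it. Then the following are equivalent: 1. $I_{\mathcal S}$ is robust; 2. $\mathcal S$ is $2$-generated, i.e. $m=2$; 3. $I_{\mathcal S}$ is a principal ideal. -/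

import Mathlib

/-- A numerical semigroup is a submonoid of `(ℕ, +)` with finite complement. -/
def IsNumericalSemigroup (S : AddSubmonoid ℕ) : Prop :=
  ((S : Set ℕ)ᶜ).Finite

/-- `A` is a minimal (for inclusion) generating set of the monoid `S`. -/
def IsMinimalGeneratingSet (S : AddSubmonoid ℕ) (A : Set ℕ) : Prop :=
  Minimal (fun B : Set ℕ => AddSubmonoid.closure B = S) A

/-- The toric ideal `I_A` of a set `A ⊆ ℕ`, in the polynomial ring with one variable `x_a` for
every `a ∈ A`: the ideal generated by all binomials `x^u - x^v` with equal `A`-degrees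
`∑ u_a * a = ∑ v_a * a`. -/
noncomputable def toricIdeal (K : Type*) [Field K] (A : Set ℕ) : Ideal (MvPolynomial A K) :=
  Ideal.span {f | ∃ u v : A →₀ ℕ,
    Finsupp.weight (fun a : A => (a : ℕ)) u = Finsupp.weight (fun a : A => (a : ℕ)) v ∧
    f = MvPolynomial.monomial u (1 : K) - MvPolynomial.monomial v (1 : K)}

/-- `G` is the reduced Groebner basis of `I` with respect to the monomial order `m`: `G ⊆ I`, the
leading terms of `G` generate the initial ideal of `I`, every element of `G` is monic, and no
monomial of an element of `G` is divisible by the leading monomial of another element. -/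
def IsReducedGroebnerBasis {σ K : Type*} [Field K] (m : MonomialOrder σ)
    (I : Ideal (MvPolynomial σ K)) (G : Set (MvPolynomial σ K)) : Prop :=
  G ⊆ (I : Set (MvPolynomial σ K)) ∧
  Ideal.span (m.leadingTerm '' G) = Ideal.span (m.leadingTerm '' (I : Set (MvPolynomial σ K))) ∧
  (∀ g ∈ G, m.leadingCoeff g = 1) ∧
  ∀ g ∈ G, ∀ h ∈ G, h ≠ g → ∀ u ∈ g.support, ¬ m.degree h ≤ u

/-- The universal Groebner basis: the union of all reduced Groebner bases of `I`. (Every monomial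
order on `σ →₀ ℕ` has a copy whose ordered monoid lies in the universe of `σ`.) -/
def universalGroebnerBasis {σ : Type} {K : Type*} [Field K]
    (I : Ideal (MvPolynomial σ K)) : Set (MvPolynomial σ K) :=
  {f | ∃ (m : MonomialOrder.{0, 0} σ) (G : Set (MvPolynomial σ K)),
    IsReducedGroebnerBasis m I G ∧ f ∈ G}

/-- `G` consists of exactly one representative of each element of `U` up to a nonzero scalar
factor (the units of a polynomial ring over a field are the nonzero constants). -/
def IsRepresentativeSet {σ K : Type*} [Field K] (U G : Set (MvPolynomial σ K)) : Prop :=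
  G ⊆ U ∧ ∀ f ∈ U, ∃! g, g ∈ G ∧ Associated g f

/-- An ideal is robust if its universal Groebner basis is a minimal set of generators. As usual,
polynomials that differ by a nonzero scalar factor are identified: a monic binomial `x^u - x^v`
of one reduced basis may appear as `x^v - x^u` in another. -/
def IsRobustIdeal {σ : Type} {K : Type*} [Field K] (I : Ideal (MvPolynomial σ K)) : Prop :=
  ∃ G : Set (MvPolynomial σ K), IsRepresentativeSet (universalGroebnerBasis I) G ∧
    Minimal (fun H : Set (MvPolynomial σ K) => Ideal.span H = I) G

/-! The argument rests on the circuits `x_i^(lcm/i) - x_j^(lcm/j)`. A lex order with `x_j` smallest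
and `x_i` next puts each of them in the universal Gröbner basis
(`circuit_mem_universalGroebnerBasis`).

With two generators, the circuit divides every defining binomial, so the ideal is principal and all
its reduced bases consist of one multiple of the circuit.

With three generators, a principal generator would divide circuits that avoid any given variable. It
would be constant, hence zero, since the ideal vanishes at `(1, …, 1)`. For robustness, take `a`,
`c` with the largest of the three lcms: the circuit of `a`, `c` is a combination of the other two
circuits and a binomial of smaller degree (`circuit_eq_combination`). Universal Gröbner basis
elements are homogeneous, so that binomial is generated without the representative of this circuit,
which is therefore redundant. -/

open MvPolynomial Finsupp

/-! ### Minimal generating sets of numerical semigroups -/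

namespace IsMinimalGeneratingSet

variable {S : AddSubmonoid ℕ} {A : Set ℕ}

lemma notMem_closure_diff (hA : IsMinimalGeneratingSet S A) {a : ℕ} (ha : a ∈ A) :
    a ∉ AddSubmonoid.closure (A \ {a}) := by
  intro h
  have hcl : AddSubmonoid.closure (A \ {a}) = S := by
    rw [← hA.prop]
    refine le_antisymm (AddSubmonoid.closure_mono Set.sdiff_subset) ?_
    rw [AddSubmonoid.closure_le]
    intro b hb
    by_cases hba : b = a
    · exact hba ▸ h
    · exact AddSubmonoid.subset_closure ⟨hb, hba⟩
  exact (hA.le_of_le hcl Set.sdiff_subset ha).2 rfl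

lemma zero_notMem (hA : IsMinimalGeneratingSet S A) : 0 ∉ A :=
  fun h => hA.notMem_closure_diff h (zero_mem _)

/-- Otherwise `c = b + k * a` would be redundant. Hence each residue class modulo `a` holds at most
one generator, which gives finiteness. -/
lemma eq_of_mod_eq (hA : IsMinimalGeneratingSet S A) {a b c : ℕ} (ha : a ∈ A) (hb : b ∈ A)
    (hc : c ∈ A) (hmod : b % a = c % a) : ¬ b < c := by
  intro hbc
  have hb0 : b ≠ 0 := fun h => hA.zero_notMem (h ▸ hb)
  have hca : a ≠ c := by
    rintro rfl
    rw [Nat.mod_self, Nat.mod_eq_of_lt hbc] at hmod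
    exact hb0 hmod
  obtain ⟨k, hk⟩ := (Nat.modEq_iff_dvd' hbc.le).mp hmod
  apply hA.notMem_closure_diff hc
  have hck : b + k • a = c := by
    rw [smul_eq_mul, mul_comm, ← hk]
    omega
  have hmem : b + k • a ∈ AddSubmonoid.closure (A \ {c}) :=
    add_mem (AddSubmonoid.subset_closure (Set.mem_sdiff_singleton.mpr ⟨hb, hbc.ne⟩))
      (nsmul_mem (AddSubmonoid.subset_closure (Set.mem_sdiff_singleton.mpr ⟨ha, hca⟩)) k)
  rwa [hck] at hmem

lemma finite (hA : IsMinimalGeneratingSet S A) : A.Finite := by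
  rcases A.eq_empty_or_nonempty with rfl | ⟨a, ha⟩
  · exact Set.finite_empty
  have ha0 : 0 < a := Nat.pos_of_ne_zero fun h => hA.zero_notMem (h ▸ ha)
  refine Set.Finite.of_injOn (f := (· % a)) (t := Set.Iio a) (fun b _ => Nat.mod_lt b ha0) ?_
    (Set.finite_Iio a)
  intro b hb c hc hbc
  exact le_antisymm (not_lt.mp (hA.eq_of_mod_eq ha hc hb hbc.symm))
    (not_lt.mp (hA.eq_of_mod_eq ha hb hc hbc))

lemma two_le_ncard (hA : IsMinimalGeneratingSet S A) (hS : IsNumericalSemigroup S)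
    (hS' : S ≠ ⊤) : 2 ≤ A.ncard := by
  by_contra hlt
  -- The empty set is covered by `d = 0`. In both cases `S` consists of multiples of `d`, yet it
  -- contains two consecutive integers.
  have hsub : ∃ d, A ⊆ {d} ∧ d ≠ 1 := by
    have h1 : A.ncard ≤ 1 := by omega
    rcases (Set.ncard_le_one_iff_eq hA.finite).mp h1 with rfl | ⟨a, rfl⟩
    · exact ⟨0, Set.empty_subset _, by norm_num⟩
    · refine ⟨a, subset_rfl, ?_⟩
      rintro rfl
      exact hS' (hA.prop.symm.trans Nat.addSubmonoidClosure_one)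
  obtain ⟨d, hAd, hd⟩ := hsub
  have hdvd : ∀ n ∈ S, d ∣ n := by
    intro n hn
    rw [← hA.prop] at hn
    have := AddSubmonoid.closure_mono hAd hn
    obtain ⟨k, rfl⟩ := AddSubmonoid.mem_closure_singleton.mp this
    exact Dvd.intro_left k rfl
  obtain ⟨N, hN⟩ := hS.bddAbove
  have hmem : ∀ n, N < n → n ∈ S := fun n hn => by
    by_contra h
    exact absurd (hN (show n ∈ (S : Set ℕ)ᶜ from h)) (not_le.mpr hn)
  have h1 := hdvd _ (hmem (N + 1) (by omega))
  have h2 := hdvd _ (hmem (N + 1 + 1) (by omega))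
  exact hd (Nat.dvd_one.mp ((Nat.dvd_add_right h1).mp h2))

end IsMinimalGeneratingSet

/-! ### Reduced Gröbner bases -/

namespace IsReducedGroebnerBasis

variable {σ K : Type*} [Field K] {m : MonomialOrder σ} {I : Ideal (MvPolynomial σ K)}
  {G : Set (MvPolynomial σ K)}

lemma ne_zero (hG : IsReducedGroebnerBasis m I G) {g : MvPolynomial σ K} (hg : g ∈ G) :
    g ≠ 0 :=
  m.leadingCoeff_ne_zero_iff.mp (by simp [hG.2.2.1 g hg])

lemma exists_degree_le (hG : IsReducedGroebnerBasis m I G) {f : MvPolynomial σ K}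
    (hf : f ∈ I) (hf0 : f ≠ 0) : ∃ g ∈ G, m.degree g ≤ m.degree f := by
  classical
  have himage : m.leadingTerm '' G = (fun s => monomial s (1 : K)) '' (m.degree '' G) := by
    rw [Set.image_image]
    refine Set.image_congr fun g hg => ?_
    rw [MonomialOrder.leadingTerm, hG.2.2.1 g hg]
  have hmem : m.leadingTerm f ∈ Ideal.span (m.leadingTerm '' G) := by
    rw [hG.2.1]
    exact Ideal.subset_span ⟨f, hf, rfl⟩
  rw [himage, mem_ideal_span_monomial_image] at hmem
  obtain ⟨_, ⟨g, hg, rfl⟩, hle⟩ := hmem (m.degree f) (by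
    rw [m.support_leadingTerm, if_neg hf0]
    exact Finset.mem_singleton_self _)
  exact ⟨g, hg, hle⟩

/-- The elements of a reduced Gröbner basis of a homogeneous ideal are homogeneous. -/
lemma exists_isWeightedHomogeneous {w : σ → ℕ} (hG : IsReducedGroebnerBasis m I G)
    (hI : ∀ f ∈ I, ∀ d, weightedHomogeneousComponent w d f ∈ I) {g : MvPolynomial σ K}
    (hg : g ∈ G) : IsWeightedHomogeneous w g (weight w (m.degree g)) := by
  classical
  set d := weight w (m.degree g) with hd
  -- The leading monomial of `r` is a monomial of `g`. By reducedness only `g` itself can have a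
  -- leading monomial dividing it, so the two leading monomials agree, although their weights
  -- differ.
  set r := g - weightedHomogeneousComponent w d g with hr
  have hcoeff : ∀ u, coeff u r = if weight w u = d then 0 else coeff u g := by
    intro u
    rw [hr, coeff_sub, coeff_weightedHomogeneousComponent]
    split_ifs <;> simp
  have hr0 : r = 0 := by
    by_contra hne
    have hrI : r ∈ I := I.sub_mem (hG.1 hg) (hI g (hG.1 hg) d)
    obtain ⟨h, hh, hle⟩ := hG.exists_degree_le hrI hne
    have hc : coeff (m.degree r) r ≠ 0 := m.coeff_degree_ne_zero_iff.mpr hne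
    rw [hcoeff] at hc
    have hw : weight w (m.degree r) ≠ d := fun h => hc (if_pos h)
    rw [if_neg hw] at hc
    have hsupp : m.degree r ∈ g.support := MvPolynomial.mem_support_iff.mpr hc
    by_cases hgh : h = g
    · subst hgh
      have heq : m.degree r = m.degree h :=
        m.toSyn.injective (le_antisymm (m.le_degree hsupp) (m.toSyn_monotone hle))
      exact hw (by rw [heq])
    · exact hG.2.2.2 g hg h hh hgh _ hsupp hle
  have heq : g = weightedHomogeneousComponent w d g := sub_eq_zero.mp hr0
  rw [heq]
  exact weightedHomogeneousComponent_isWeightedHomogeneous d g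

/-- A reduced Gröbner basis of a principal ideal consists of a single scalar multiple of the
generator. -/
lemma associated_of_eq_span_singleton {f : MvPolynomial σ K} (hf : f ≠ 0)
    (hG : IsReducedGroebnerBasis m (Ideal.span {f}) G) {g : MvPolynomial σ K} (hg : g ∈ G) :
    Associated f g := by
  have key : ∀ h ∈ Ideal.span {f}, h ≠ 0 → m.degree f ≤ m.degree h ∧
      (m.degree h ≤ m.degree f → Associated f h) := by
    intro h hh h0
    obtain ⟨q, rfl⟩ := Ideal.mem_span_singleton'.mp hh
    have hq0 : q ≠ 0 := left_ne_zero_of_mul h0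
    rw [m.degree_mul hq0 hf]
    refine ⟨le_add_self, fun hle => ?_⟩
    have hq : m.degree q = 0 := by
      ext x
      have := hle x
      simp only [Finsupp.add_apply] at this
      simp only [Finsupp.coe_zero, Pi.zero_apply]
      omega
    have hqC := MonomialOrder.eq_C_of_degree_eq_zero hq
    have hunit : IsUnit q := by
      rw [hqC]
      exact (isUnit_iff_ne_zero.mpr (m.leadingCoeff_ne_zero_iff.mpr hq0)).map C
    rw [mul_comm]
    exact (associated_mul_isUnit_right_iff hunit).mpr (Associated.refl f)
  obtain ⟨h, hh, hle⟩ := hG.exists_degree_le (Ideal.mem_span_singleton_self f) hf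
  have hgh : h = g := by
    by_contra hne
    exact hG.2.2.2 g hg h hh hne _ (m.degree_mem_support (hG.ne_zero hg))
      (hle.trans (key g (hG.1 hg) (hG.ne_zero hg)).1)
  subst hgh
  exact (key h (hG.1 hh) (hG.ne_zero hh)).2 hle

end IsReducedGroebnerBasis

/-! ### An elimination order -/

/-- The lexicographic order for which `j` is the smallest variable and `i` the second smallest. -/
lemma exists_monomialOrder_eliminating {σ : Type} [Finite σ] {i j : σ} (hij : i ≠ j) :
    ∃ m : MonomialOrder.{0, 0} σ,
      (∀ (v : σ →₀ ℕ) (q : ℕ), m.toSyn v < m.toSyn (single j q) → ∀ k, k ≠ j → v k = 0) ∧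
      (∀ (v : σ →₀ ℕ) (p : ℕ), m.toSyn v < m.toSyn (single i p) →
        v i < p ∧ ∀ k, k ≠ i → k ≠ j → v k = 0) := by
  classical
  obtain ⟨e, he⟩ := exists_injective_nat σ
  -- In `MonomialOrder.lex` a smaller index is a larger variable, so `j` gets the top rank; `e` only
  -- breaks ties.
  let r : σ → ℕ := fun k => if k = j then 2 else if k = i then 1 else 0
  let f : σ → ℕ ×ₗ ℕ := fun k => toLex (r k, e k)
  have hf : Function.Injective f := fun a b hab =>
    he (congrArg (fun x : ℕ ×ₗ ℕ => (ofLex x).2) hab)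
  let ord : LinearOrder σ := LinearOrder.lift' f hf
  have hlt : ∀ a b : σ, r a < r b → a < b := fun a b h =>
    show f a < f b from Prod.Lex.lt_iff.mpr (Or.inl h)
  have hrj : r j = 2 := if_pos rfl
  have hri : r i = 1 := by simp [r, hij]
  have hr0 : ∀ k, k ≠ i → k ≠ j → r k = 0 := fun k hi hj => by simp [r, hi, hj]
  refine ⟨MonomialOrder.lex, fun v q hv k hk => ?_, fun v p hv => ?_⟩
  · obtain ⟨l, hl, hvl⟩ := Finsupp.Lex.lt_iff.mp (MonomialOrder.lex_lt_iff.mp hv)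
    simp only [ofLex_toLex] at hl hvl
    have hlj : l = j := by
      by_contra hne
      simp [Ne.symm hne] at hvl
    subst hlj
    have hkl : k < l := hlt k l (by
      rw [hrj]
      by_cases hki : k = i
      · rw [hki, hri]; norm_num
      · rw [hr0 k hki hk]; norm_num)
    rw [hl k hkl, Finsupp.single_eq_of_ne hk]
  · obtain ⟨l, hl, hvl⟩ := Finsupp.Lex.lt_iff.mp (MonomialOrder.lex_lt_iff.mp hv)
    simp only [ofLex_toLex] at hl hvl
    have hli : l = i := by
      by_contra hne
      simp [Ne.symm hne] at hvl
    subst hli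
    refine ⟨by simpa using hvl, fun k hki hkj => ?_⟩
    rw [hl k (hlt k l (by rw [hri, hr0 k hki hkj]; norm_num)), Finsupp.single_eq_of_ne hki]

/-! ### Toric ideals -/

namespace toricIdeal

variable {K : Type*} [Field K] {A : Set ℕ}

/-- The `A`-degree of a monomial. -/
noncomputable abbrev deg (u : A →₀ ℕ) : ℕ := weight (fun a : A => (a : ℕ)) u

lemma binomial_mem {u v : A →₀ ℕ} (h : deg u = deg v) :
    monomial u (1 : K) - monomial v (1 : K) ∈ toricIdeal K A :=
  Ideal.subset_span ⟨u, v, h, rfl⟩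

lemma component_mem_span {s : Set (MvPolynomial A K)}
    (hs : ∀ g ∈ s, ∃ d, IsWeightedHomogeneous (fun a : A => (a : ℕ)) g d)
    {f : MvPolynomial A K} (hf : f ∈ Ideal.span s) (d : ℕ) :
    weightedHomogeneousComponent (fun a : A => (a : ℕ)) d f ∈ Ideal.span s :=
  letI := weightedGradedAlgebra K (fun a : A => (a : ℕ))
  weightedHomogeneousComponent_mem_of_mem K _
    (Ideal.homogeneous_span (weightedHomogeneousSubmodule K (fun a : A => (a : ℕ))) s
      fun g hg => hs g hg) hf d

lemma component_mem {f : MvPolynomial A K} (hf : f ∈ toricIdeal K A) (d : ℕ) :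
    weightedHomogeneousComponent (fun a : A => (a : ℕ)) d f ∈ toricIdeal K A := by
  refine component_mem_span ?_ hf d
  rintro _ ⟨u, v, huv, rfl⟩
  exact ⟨deg u, (isWeightedHomogeneous_monomial _ u 1 rfl).sub
    (isWeightedHomogeneous_monomial _ v 1 huv.symm)⟩

/-- This excludes single nonzero terms, in particular nonzero constants, from the ideal. -/
lemma eval_one_eq_zero {f : MvPolynomial A K} (hf : f ∈ toricIdeal K A) :
    eval (fun _ => (1 : K)) f = 0 := by
  have hle : toricIdeal K A ≤ RingHom.ker (eval (fun _ : A => (1 : K))) := by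
    refine Ideal.span_le.mpr ?_
    rintro _ ⟨u, v, -, rfl⟩
    simp [RingHom.mem_ker, eval_monomial]
  exact hle hf

/-- A monomial occurring in an element of the toric ideal shares its fiber with another one. -/
lemma exists_mem_support_ne {f : MvPolynomial A K} (hf : f ∈ toricIdeal K A) {u : A →₀ ℕ}
    (hu : u ∈ f.support) : ∃ v ∈ f.support, v ≠ u ∧ deg v = deg u := by
  classical
  by_contra! hne
  have hcomp : weightedHomogeneousComponent (fun a : A => (a : ℕ)) (deg u) f =
      monomial u (coeff u f) := by
    ext v
    rw [coeff_weightedHomogeneousComponent, coeff_monomial]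
    by_cases hvu : u = v
    · subst hvu; simp
    · rw [if_neg hvu, ite_eq_right_iff]
      intro hdeg
      by_contra hv
      exact hne v (MvPolynomial.mem_support_iff.mpr hv) (Ne.symm hvu) hdeg
  have h0 := eval_one_eq_zero (component_mem hf (deg u))
  rw [hcomp, eval_monomial] at h0
  simp only [one_pow, Finsupp.prod, Finset.prod_const_one, mul_one] at h0
  exact MvPolynomial.mem_support_iff.mp hu h0

/-! ### The reduced Gröbner basis of a toric ideal -/

section GroebnerBasis

variable (m : MonomialOrder.{0, 0} A)

/-- A monomial is nonstandard if it is not the smallest one in its fiber. -/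
def IsNonstandard (u : A →₀ ℕ) : Prop := ∃ v : A →₀ ℕ, deg v = deg u ∧ m.toSyn v < m.toSyn u

/-- Binomials of a minimal nonstandard monomial and the smallest monomial in its fiber. -/
def reducedBasis (K : Type*) [Field K] : Set (MvPolynomial A K) :=
  {g | ∃ u v : A →₀ ℕ, Minimal (IsNonstandard m) u ∧ deg v = deg u ∧ ¬ IsNonstandard m v ∧
    g = monomial u (1 : K) - monomial v (1 : K)}

variable {m}

lemma lt_of_isNonstandard {u v : A →₀ ℕ} (hu : IsNonstandard m u) (hv : ¬ IsNonstandard m v)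
    (h : deg v = deg u) : m.toSyn v < m.toSyn u := by
  obtain ⟨x, hx, hxu⟩ := hu
  by_contra hlt
  exact hv ⟨x, hx.trans h.symm, hxu.trans_le (not_lt.mp hlt)⟩

lemma degree_binomial {u v : A →₀ ℕ} (h : m.toSyn v < m.toSyn u) :
    m.degree (monomial u (1 : K) - monomial v (1 : K)) = u := by
  classical
  have hu : m.degree (monomial u (1 : K)) = u := by simp [m.degree_monomial]
  have hv : m.degree (monomial v (1 : K)) = v := by simp [m.degree_monomial]
  rw [m.degree_sub_of_lt (by rwa [hu, hv]), hu]

lemma leadingCoeff_binomial {u v : A →₀ ℕ} (h : m.toSyn v < m.toSyn u) :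
    m.leadingCoeff (monomial u (1 : K) - monomial v (1 : K)) = 1 := by
  classical
  have hu : m.degree (monomial u (1 : K)) = u := by simp [m.degree_monomial]
  have hv : m.degree (monomial v (1 : K)) = v := by simp [m.degree_monomial]
  rw [m.leadingCoeff_sub_of_lt (by rwa [hu, hv]), m.leadingCoeff_monomial]

lemma IsNonstandard.mono {u v : A →₀ ℕ} (hu : IsNonstandard m u) (huv : u ≤ v) :
    IsNonstandard m v := by
  obtain ⟨x, hx, hxu⟩ := hu
  obtain ⟨y, rfl⟩ := exists_add_of_le huv
  refine ⟨x + y, ?_, ?_⟩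
  · simp only [deg, map_add] at hx ⊢
    rw [hx]
  · simpa only [map_add] using add_lt_add_left hxu _

variable (m) in
lemma exists_not_isNonstandard (u : A →₀ ℕ) : ∃ v, deg v = deg u ∧ ¬ IsNonstandard m v := by
  obtain ⟨v, hv, hmin⟩ := (InvImage.wf m.toSyn (wellFounded_lt (α := m.syn))).has_min
    {v | deg v = deg u} ⟨u, rfl⟩
  exact ⟨v, hv, fun ⟨x, hx, hxv⟩ => hmin x (hx.trans hv) hxv⟩

variable (m K) in
-- The leading monomial of an ideal element has a smaller monomial in its fiber, so it is
-- nonstandard and lies above a minimal nonstandard one. Tails are standard, and standard monomials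
-- are closed under division, whence reducedness.
lemma isReducedGroebnerBasis_reducedBasis [Finite A] :
    IsReducedGroebnerBasis m (toricIdeal K A) (reducedBasis m K) := by
  have hsub : reducedBasis m K ⊆ (toricIdeal K A : Set (MvPolynomial A K)) := by
    rintro _ ⟨u, v, -, hdeg, -, rfl⟩
    exact binomial_mem hdeg.symm
  refine ⟨hsub, le_antisymm (Ideal.span_mono (Set.image_mono hsub)) ?_, ?_, ?_⟩
  · refine Ideal.span_le.mpr ?_
    rintro _ ⟨f, hf, rfl⟩
    by_cases hf0 : f = 0
    · rw [hf0, m.leadingTerm_zero]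
      exact zero_mem _
    obtain ⟨x, hx, hne, hdeg⟩ := exists_mem_support_ne hf (m.degree_mem_support hf0)
    have hns : IsNonstandard m (m.degree f) :=
      ⟨x, hdeg, (m.le_degree hx).lt_of_ne fun h => hne (m.toSyn.injective h)⟩
    obtain ⟨u, hle, hu⟩ := exists_minimal_le_of_wellFoundedLT (IsNonstandard m) _ hns
    obtain ⟨v, hv, hvs⟩ := exists_not_isNonstandard m u
    have hlt := lt_of_isNonstandard hu.prop hvs hv
    have hlead : m.leadingTerm (monomial u (1 : K) - monomial v (1 : K)) = monomial u 1 := by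
      rw [MonomialOrder.leadingTerm, degree_binomial hlt, leadingCoeff_binomial hlt]
    have hmem : monomial u (1 : K) ∈ Ideal.span (m.leadingTerm '' reducedBasis m K) :=
      Ideal.subset_span ⟨_, ⟨u, v, hu, hv, hvs, rfl⟩, hlead⟩
    have heq : m.leadingTerm f =
        monomial (m.degree f - u) (m.leadingCoeff f) * monomial u (1 : K) := by
      rw [monomial_mul, tsub_add_cancel_of_le hle, mul_one, MonomialOrder.leadingTerm]
    rw [SetLike.mem_coe, heq]
    exact Ideal.mul_mem_left _ _ hmem
  · rintro _ ⟨u, v, hu, hv, hvs, rfl⟩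
    exact leadingCoeff_binomial (lt_of_isNonstandard hu.prop hvs hv)
  · rintro _ ⟨u, v, hu, hv, hvs, rfl⟩ _ ⟨u', v', hu', hv', hvs', rfl⟩ hne x hx hle
    rw [degree_binomial (lt_of_isNonstandard hu'.prop hvs' hv')] at hle
    have hcases : x = u ∨ x = v := by
      classical
      have := support_sub _ _ _ hx
      simpa [support_monomial] using this
    rcases hcases with rfl | rfl
    · have hxu : u' = x := hu.eq_of_le hu'.prop hle
      subst hxu
      have hvv : v' = v := m.toSyn.injective (le_antisymm
        (not_lt.mp fun h => hvs' ⟨v, hv.trans hv'.symm, h⟩)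
        (not_lt.mp fun h => hvs ⟨v', hv'.trans hv.symm, h⟩))
      exact hne (by rw [hvv])
    · exact hvs (hu'.prop.mono hle)

end GroebnerBasis

/-! ### Circuits -/

variable (K) in
/-- The binomial of smallest positive degree in the toric ideal that involves only the variables
`i` and `j`. -/
noncomputable def circuit (i j : A) : MvPolynomial A K :=
  X i ^ (Nat.lcm i j / i) - X j ^ (Nat.lcm i j / j)

lemma circuit_eq_monomial (i j : A) : circuit K i j =
    monomial (single i (Nat.lcm i j / i)) 1 - monomial (single j (Nat.lcm i j / j)) 1 := by
  simp only [circuit, X_pow_eq_monomial]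

lemma deg_single (i : A) (n : ℕ) : deg (single i n) = n * (i : ℕ) := by
  simp [deg, weight_single]

lemma deg_single_lcm_left (i j : A) : deg (single i (Nat.lcm i j / i)) = Nat.lcm i j := by
  rw [deg_single, Nat.div_mul_cancel (Nat.dvd_lcm_left _ _)]

lemma deg_single_lcm_right (i j : A) : deg (single j (Nat.lcm i j / j)) = Nat.lcm i j := by
  rw [deg_single, Nat.div_mul_cancel (Nat.dvd_lcm_right _ _)]

lemma circuit_mem (i j : A) : circuit K i j ∈ toricIdeal K A := by
  rw [circuit_eq_monomial]
  exact binomial_mem (by rw [deg_single_lcm_left, deg_single_lcm_right])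

lemma circuit_isWeightedHomogeneous (i j : A) :
    IsWeightedHomogeneous (fun a : A => (a : ℕ)) (circuit K i j) (Nat.lcm i j) := by
  rw [circuit_eq_monomial]
  exact (isWeightedHomogeneous_monomial _ _ _ (deg_single_lcm_left i j)).sub
    (isWeightedHomogeneous_monomial _ _ _ (deg_single_lcm_right i j))

lemma pos_of_zero_notMem (hA : 0 ∉ A) (i : A) : 0 < (i : ℕ) :=
  Nat.pos_of_ne_zero fun h => hA (h ▸ i.2)

lemma lcm_div_left_pos (hA : 0 ∉ A) (i j : A) : 0 < Nat.lcm i j / i :=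
  Nat.div_pos (Nat.le_of_dvd (Nat.lcm_pos (pos_of_zero_notMem hA i) (pos_of_zero_notMem hA j))
    (Nat.dvd_lcm_left _ _)) (pos_of_zero_notMem hA i)

lemma lcm_div_right_pos (hA : 0 ∉ A) (i j : A) : 0 < Nat.lcm i j / j := by
  rw [Nat.lcm_comm]
  exact lcm_div_left_pos hA j i

lemma eval_circuit_right (hA : 0 ∉ A) {i j : A} (hij : i ≠ j) :
    eval (Pi.single j (1 : K)) (circuit K i j) = -1 := by
  simp [circuit, Pi.single_eq_of_ne hij, (lcm_div_left_pos hA i j).ne']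

lemma eval_circuit_of_ne (hA : 0 ∉ A) {i j k : A} (hik : i ≠ k) (hjk : j ≠ k) :
    eval (Pi.single k (1 : K)) (circuit K i j) = 0 := by
  simp [circuit, Pi.single_eq_of_ne hik, Pi.single_eq_of_ne hjk, (lcm_div_left_pos hA i j).ne',
    (lcm_div_right_pos hA i j).ne']

lemma circuit_ne_zero (hA : 0 ∉ A) {i j : A} (hij : i ≠ j) : circuit K i j ≠ 0 := by
  intro h
  have := eval_circuit_right (K := K) hA hij
  simp [h] at this

/-- A variable of one circuit that is missing in another one tells the two apart. -/
lemma not_associated_of_eval {f g : MvPolynomial A K} {x : A → K} (hf : eval x f = 0)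
    (hg : eval x g ≠ 0) : ¬ Associated f g := by
  rintro ⟨u, rfl⟩
  simp [hf] at hg

lemma lcm_div_le_of_mul_eq (hA : 0 ∉ A) {i j : A} {p s : ℕ} (hp : 0 < p)
    (h : p * (i : ℕ) = s * j) : Nat.lcm i j / i ≤ p := by
  have hi := pos_of_zero_notMem hA i
  have hdvd : Nat.lcm i j ∣ p * i := Nat.lcm_dvd (Dvd.intro_left p rfl) (h ▸ Dvd.intro_left s rfl)
  exact Nat.div_le_of_le_mul (by rw [mul_comm]; exact Nat.le_of_dvd (by positivity) hdvd)

/-- Every circuit lies in the universal Gröbner basis. -/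
lemma circuit_mem_universalGroebnerBasis [Finite A] (hA : 0 ∉ A) {i j : A} (hij : i ≠ j) :
    circuit K i j ∈ universalGroebnerBasis (toricIdeal K A) := by
  obtain ⟨m, hmj, hmi⟩ := exists_monomialOrder_eliminating hij
  refine ⟨m, _, isReducedGroebnerBasis_reducedBasis K m,
    single i (Nat.lcm i j / i), single j (Nat.lcm i j / j), ?_, ?_, ?_, circuit_eq_monomial i j⟩
  · have hlt : m.toSyn (single j (Nat.lcm i j / j)) < m.toSyn (single i (Nat.lcm i j / i)) := by
      by_contra hle
      rcases (not_lt.mp hle).lt_or_eq with h | h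
      · have := hmj _ _ h i hij
        rw [single_eq_same] at this
        exact (lcm_div_left_pos hA i j).ne' this
      · have := DFunLike.congr_fun (m.toSyn.injective h) i
        rw [single_eq_same, single_eq_of_ne hij] at this
        exact (lcm_div_left_pos hA i j).ne' this
    -- A nonstandard proper divisor would be a power of `x_i` with a smaller fiber mate in `x_i`,
    -- `x_j` alone. Cancelling `x_i` gives a common multiple of `i` and `j` below the lcm.
    refine minimal_iff_forall_lt.mpr ⟨⟨_, ?_, hlt⟩, ?_⟩
    · rw [deg_single_lcm_left, deg_single_lcm_right]
    · rintro u hu ⟨v, hv, hvu⟩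
      have hus : u = single i (u i) := by
        ext k
        by_cases hk : k = i
        · rw [hk, single_eq_same]
        · have := hu.le k
          rw [single_eq_of_ne hk] at this ⊢
          omega
      have hui : u i < Nat.lcm i j / i := by
        by_contra hle
        refine hu.not_ge ?_
        rw [hus]
        exact Finsupp.single_le_single.mpr (not_lt.mp hle)
      rw [hus] at hvu hv
      obtain ⟨hvi, hv0⟩ := hmi v _ hvu
      have hvs : v = single i (v i) + single j (v j) := by
        ext k
        by_cases hki : k = i
        · subst hki; simp [single_eq_of_ne hij]
        · by_cases hkj : k = j
          · subst hkj; simp [single_eq_of_ne hki]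
          · simp [single_eq_of_ne hki, single_eq_of_ne hkj, hv0 k hki hkj]
      rw [hvs, deg, map_add] at hv
      change deg _ + deg _ = deg _ at hv
      rw [deg_single, deg_single, deg_single] at hv
      have := lcm_div_le_of_mul_eq hA (i := i) (j := j) (p := u i - v i) (s := v j) (by omega)
        (by rw [Nat.sub_mul]; omega)
      omega
  · rw [deg_single_lcm_left, deg_single_lcm_right]
  · rintro ⟨v, hv, hlt⟩
    have hvs : v = single j (v j) := by
      ext k
      by_cases hk : k = j
      · rw [hk, single_eq_same]
      · rw [hmj v _ hlt k hk, single_eq_of_ne hk]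
    rw [hvs, deg_single, deg_single] at hv
    rw [hvs, Nat.eq_of_mul_eq_mul_right (pos_of_zero_notMem hA j) hv] at hlt
    exact lt_irrefl _ hlt

/-! ### Two generators -/

lemma circuit_dvd_of_le (hA : 0 ∉ A) (i j : A) {p q p' q' : ℕ} (hp : p' ≤ p)
    (h : p * (i : ℕ) + q * j = p' * i + q' * j) :
    circuit K i j ∣ X i ^ p * X j ^ q - X i ^ p' * X j ^ q' := by
  have hi := pos_of_zero_notMem hA i
  have hj := pos_of_zero_notMem hA j
  have hpi : p' * (i : ℕ) ≤ p * i := Nat.mul_le_mul_right _ hp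
  have hqj : q * (j : ℕ) ≤ q' * j := by omega
  have hq : q ≤ q' := Nat.le_of_mul_le_mul_right hqj hj
  have heq : (p - p') * (i : ℕ) = (q' - q) * j := by
    rw [Nat.sub_mul, Nat.sub_mul]; omega
  obtain ⟨k, hk⟩ : Nat.lcm i j ∣ (p - p') * i :=
    Nat.lcm_dvd (Dvd.intro_left _ rfl) (heq ▸ Dvd.intro_left _ rfl)
  have h1 : p = p' + Nat.lcm i j / i * k := by
    have : p - p' = Nat.lcm i j / i * k := Nat.eq_of_mul_eq_mul_right hi (by
      rw [hk, mul_right_comm, Nat.div_mul_cancel (Nat.dvd_lcm_left _ _)])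
    omega
  have h2 : q' = q + Nat.lcm i j / j * k := by
    have : q' - q = Nat.lcm i j / j * k := Nat.eq_of_mul_eq_mul_right hj (by
      rw [← heq, hk, mul_right_comm, Nat.div_mul_cancel (Nat.dvd_lcm_right _ _)])
    omega
  -- With the common monomial removed, `y^k - z^k` remains, where `y - z` is the circuit.
  have hfactor : (X i ^ p * X j ^ q - X i ^ p' * X j ^ q' : MvPolynomial A K) =
      X i ^ p' * X j ^ q *
        ((X i ^ (Nat.lcm i j / i)) ^ k - (X j ^ (Nat.lcm i j / j)) ^ k) := by
    rw [h1, h2, pow_add, pow_add, pow_mul, pow_mul]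
    ring
  rw [hfactor]
  exact (sub_dvd_pow_sub_pow _ _ k).mul_left _

lemma eq_span_circuit (hA : 0 ∉ A) {i j : A} (hij : i ≠ j) (hall : ∀ k : A, k = i ∨ k = j) :
    toricIdeal K A = Ideal.span {circuit K i j} := by
  refine le_antisymm (Ideal.span_le.mpr ?_)
    ((Ideal.span_singleton_le_iff_mem _).mpr (circuit_mem i j))
  have hsum : ∀ u : A →₀ ℕ, u = single i (u i) + single j (u j) := by
    intro u
    ext k
    rcases hall k with rfl | rfl
    · simp [single_eq_of_ne hij]
    · simp [single_eq_of_ne hij.symm]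
  have hdeg : ∀ u : A →₀ ℕ, deg u = u i * (i : ℕ) + u j * j := by
    intro u
    conv_lhs => rw [hsum u, deg, map_add]
    exact congrArg₂ (· + ·) (deg_single _ _) (deg_single _ _)
  have hmon : ∀ u : A →₀ ℕ, monomial u (1 : K) = X i ^ u i * X j ^ u j := by
    intro u
    conv_lhs => rw [hsum u]
    rw [X_pow_eq_monomial, X_pow_eq_monomial, monomial_mul, one_mul]
  rintro _ ⟨u, v, huv, rfl⟩
  change deg u = deg v at huv
  rw [hdeg, hdeg] at huv
  rw [SetLike.mem_coe, Ideal.mem_span_singleton, hmon, hmon]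
  rcases le_total (v i) (u i) with h | h
  · exact circuit_dvd_of_le hA i j h huv
  · rw [← neg_sub, dvd_neg]
    exact circuit_dvd_of_le hA i j h huv.symm

lemma isRobustIdeal_of_pair [Finite A] (hA : 0 ∉ A) {i j : A} (hij : i ≠ j)
    (hall : ∀ k : A, k = i ∨ k = j) : IsRobustIdeal (toricIdeal K A) := by
  have hspan := eq_span_circuit (K := K) hA hij hall
  refine ⟨{circuit K i j}, ⟨?_, ?_⟩, hspan.symm, ?_⟩
  · exact Set.singleton_subset_iff.mpr (circuit_mem_universalGroebnerBasis hA hij)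
  · rintro f ⟨m, G, hG, hf⟩
    rw [hspan] at hG
    exact ⟨_, ⟨rfl, hG.associated_of_eq_span_singleton (circuit_ne_zero hA hij) hf⟩,
      fun g hg => hg.1⟩
  · intro H hH hle
    rcases Set.subset_singleton_iff_eq.mp hle with rfl | rfl
    · have hmem := circuit_mem (K := K) i j
      rw [← hH, Ideal.span_empty, Ideal.mem_bot] at hmem
      exact absurd hmem (circuit_ne_zero hA hij)
    · exact le_rfl

/-! ### Three or more generators -/

lemma not_isPrincipal_of_three (hA : 0 ∉ A) {a b c : A} (hab : a ≠ b) (hac : a ≠ c)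
    (hbc : b ≠ c) : ¬ Submodule.IsPrincipal (toricIdeal K A) := by
  rintro ⟨f, hf⟩
  change toricIdeal K A = Ideal.span {f} at hf
  have hdvd : ∀ i j : A, f ∣ circuit K i j := fun i j =>
    Ideal.mem_span_singleton.mp (hf ▸ circuit_mem i j)
  have hdeg : ∀ i j k : A, i ≠ j → i ≠ k → j ≠ k → degreeOf k f = 0 := by
    intro i j k hij hik hjk
    obtain ⟨q, hq⟩ := hdvd i j
    have hne := circuit_ne_zero (K := K) hA hij
    rw [hq] at hne
    have hle : degreeOf k (circuit K i j) = 0 := by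
      have := degreeOf_sub_le k (X i ^ (Nat.lcm i j / i) : MvPolynomial A K)
        (X j ^ (Nat.lcm i j / j))
      simp only [X_pow_eq_monomial, degreeOf_monomial_eq _ _ (one_ne_zero (α := K)),
        single_eq_of_ne hik.symm, single_eq_of_ne hjk.symm, max_self, Nat.le_zero] at this
      simpa only [circuit, X_pow_eq_monomial] using this
    rw [hq, degreeOf_mul_eq (left_ne_zero_of_mul hne) (right_ne_zero_of_mul hne)] at hle
    omega
  have hzero : ∀ k, degreeOf k f = 0 := by
    intro k
    by_cases hka : k = a
    · subst hka; exact hdeg b c k hbc hab.symm hac.symm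
    by_cases hkb : k = b
    · subst hkb; exact hdeg a c k hac hab hbc.symm
    exact hdeg a b k hab (Ne.symm hka) (Ne.symm hkb)
  have hC : f = C (coeff 0 f) := by
    ext u
    rw [coeff_C]
    split_ifs with hu
    · rw [hu]
    · by_contra hne
      apply hu
      ext k
      have := (degreeOf_le_iff.mp (hzero k).le) u (MvPolynomial.mem_support_iff.mpr hne)
      simp only [Finsupp.coe_zero, Pi.zero_apply]
      omega
  have heval := eval_one_eq_zero (K := K) (hf ▸ Ideal.mem_span_singleton_self f :
    f ∈ toricIdeal K A)
  rw [hC, eval_C] at heval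
  rw [heval, C_0] at hC
  exact circuit_ne_zero (K := K) hA hab (zero_dvd_iff.mp (hC ▸ hdvd a b))

/-- Homogeneous elements of degree smaller than that of `g` do not need `g` as a generator. -/
lemma mem_span_diff_of_lt {G : Set (MvPolynomial A K)}
    (hG : ∀ g ∈ G, ∃ d, IsWeightedHomogeneous (fun a : A => (a : ℕ)) g d)
    {f g : MvPolynomial A K} {d e : ℕ} (hf : f ∈ Ideal.span G) (hg : g ∈ G)
    (hfd : IsWeightedHomogeneous (fun a : A => (a : ℕ)) f d)
    (hge : IsWeightedHomogeneous (fun a : A => (a : ℕ)) g e) (hde : d < e) :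
    f ∈ Ideal.span (G \ {g}) := by
  classical
  rw [← Set.insert_eq_of_mem hg, ← Set.insert_sdiff_singleton, Ideal.mem_span_insert'] at hf
  obtain ⟨q, hq⟩ := hf
  have hcomp := component_mem_span (fun h hh => hG h hh.1) hq d
  rw [map_add, hfd.weightedHomogeneousComponent_same] at hcomp
  -- Every monomial of `q * g` has degree at least `e > d`.
  have hzero : weightedHomogeneousComponent (fun a : A => (a : ℕ)) d (q * g) = 0 := by
    refine weightedHomogeneousComponent_eq_zero' _ _ fun u hu hdeg => ?_
    obtain ⟨x, -, y, hy, rfl⟩ := Finset.mem_add.mp (support_mul _ _ hu)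
    have := hge (MvPolynomial.mem_support_iff.mp hy)
    rw [map_add, this] at hdeg
    omega
  rwa [hzero, add_zero] at hcomp

/-- If `lcm a c` is at least `lcm a b` and `lcm c b`, then the circuit of `a` and `c` is a
combination of the other two circuits and a binomial of smaller degree. -/
lemma circuit_eq_combination (hA : 0 ∉ A) (a b c : A) (hab : Nat.lcm a b ≤ Nat.lcm a c)
    (hcb : Nat.lcm c b ≤ Nat.lcm a c) : ∃ k l : ℕ, ∃ f ∈ toricIdeal K A, ∃ d < Nat.lcm a c,
      IsWeightedHomogeneous (fun a : A => (a : ℕ)) f d ∧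
      circuit K a c = X a ^ k * circuit K a b + X b * f - X c ^ l * circuit K c b := by
  have hb := pos_of_zero_notMem hA b
  -- The exponents of `x_b` are written `s + 1` and `t + 1` to split off one `x_b`: then `f = x_a^k
  -- x_b^s - x_c^l x_b^t` has degree `lcm a c - b`.
  obtain ⟨s, hs⟩ := Nat.exists_eq_succ_of_ne_zero (lcm_div_right_pos hA a b).ne'
  obtain ⟨t, ht⟩ := Nat.exists_eq_succ_of_ne_zero (lcm_div_right_pos hA c b).ne'
  have hsb : (s + 1) * (b : ℕ) = Nat.lcm a b := by
    rw [← Nat.succ_eq_add_one, ← hs, Nat.div_mul_cancel (Nat.dvd_lcm_right _ _)]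
  have htb : (t + 1) * (b : ℕ) = Nat.lcm c b := by
    rw [← Nat.succ_eq_add_one, ← ht, Nat.div_mul_cancel (Nat.dvd_lcm_right _ _)]
  obtain ⟨k, hk⟩ : ∃ k, Nat.lcm a c / a = k + Nat.lcm a b / a :=
    ⟨_, (Nat.sub_add_cancel (Nat.div_le_div_right hab)).symm⟩
  obtain ⟨l, hl⟩ : ∃ l, Nat.lcm a c / c = l + Nat.lcm c b / c :=
    ⟨_, (Nat.sub_add_cancel (Nat.div_le_div_right hcb)).symm⟩
  have hka : k * (a : ℕ) + Nat.lcm a b = Nat.lcm a c := by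
    have := congrArg (· * (a : ℕ)) hk
    simpa only [add_mul, Nat.div_mul_cancel (Nat.dvd_lcm_left _ _)] using this.symm
  have hlc : l * (c : ℕ) + Nat.lcm c b = Nat.lcm a c := by
    have := congrArg (· * (c : ℕ)) hl
    simpa only [add_mul, Nat.div_mul_cancel (Nat.dvd_lcm_left _ _),
      Nat.div_mul_cancel (Nat.dvd_lcm_right _ _)] using this.symm
  have hu : deg (single a k + single b s) = Nat.lcm a c - b := by
    rw [deg, map_add]
    change deg _ + deg _ = _
    rw [deg_single, deg_single]
    rw [add_mul, one_mul] at hsb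
    omega
  have hv : deg (single c l + single b t) = Nat.lcm a c - b := by
    rw [deg, map_add]
    change deg _ + deg _ = _
    rw [deg_single, deg_single]
    rw [add_mul, one_mul] at htb
    omega
  refine ⟨k, l, _, binomial_mem (K := K) (hu.trans hv.symm), Nat.lcm a c - b,
    Nat.sub_lt (Nat.lcm_pos (pos_of_zero_notMem hA a) (pos_of_zero_notMem hA c)) hb,
    (isWeightedHomogeneous_monomial _ _ _ hu).sub (isWeightedHomogeneous_monomial _ _ _ hv), ?_⟩
  have hmon : ∀ (i j : A) (p q : ℕ), monomial (single i p + single j q) (1 : K) =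
      X i ^ p * X j ^ q := by
    intro i j p q
    rw [X_pow_eq_monomial, X_pow_eq_monomial, monomial_mul, one_mul]
  rw [hmon, hmon, circuit, circuit, circuit, hk, hl, hs, ht, Nat.succ_eq_add_one,
    Nat.succ_eq_add_one]
  ring

lemma not_isRobustIdeal_of_lcm_le [Finite A] (hA : 0 ∉ A) {a b c : A} (hab : a ≠ b)
    (hac : a ≠ c) (hbc : b ≠ c) (h1 : Nat.lcm a b ≤ Nat.lcm a c)
    (h2 : Nat.lcm c b ≤ Nat.lcm a c) : ¬ IsRobustIdeal (toricIdeal K A) := by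
  rintro ⟨G, ⟨hGU, hrep⟩, hmin⟩
  have hhom : ∀ g ∈ G, ∃ d, IsWeightedHomogeneous (fun a : A => (a : ℕ)) g d := by
    intro g hg
    obtain ⟨m, B, hB, hgB⟩ := hGU hg
    exact ⟨_, hB.exists_isWeightedHomogeneous (fun f hf d => component_mem hf d) hgB⟩
  have hspan : Ideal.span G = toricIdeal K A := hmin.prop
  obtain ⟨g, ⟨hg, hgass⟩, -⟩ := hrep _ (circuit_mem_universalGroebnerBasis (K := K) hA hac)
  have hgd : IsWeightedHomogeneous (fun a : A => (a : ℕ)) g (Nat.lcm a c) := by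
    obtain ⟨u, hu⟩ := hgass.symm
    obtain ⟨r, -, hr⟩ := MvPolynomial.isUnit_iff_eq_C_of_isReduced.mp u.isUnit
    rw [← hu, hr, mul_comm]
    exact (circuit_isWeightedHomogeneous a c).C_mul r
  set J := Ideal.span (G \ {g}) with hJ
  have hother : ∀ i j : A, i ≠ j → ¬ Associated (circuit K i j) (circuit K a c) →
      circuit K i j ∈ J := by
    intro i j hij hnot
    obtain ⟨h, ⟨hh, hass⟩, -⟩ := hrep _ (circuit_mem_universalGroebnerBasis (K := K) hA hij)
    have hhg : h ≠ g := by
      rintro rfl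
      exact hnot (hass.symm.trans hgass)
    obtain ⟨u, hu⟩ := hass
    rw [← hu]
    exact J.mul_mem_right _ (Ideal.subset_span ⟨hh, hhg⟩)
  -- The point with `x_c = 1` and all other coordinates `0` separates the circuits; below, `x_b`
  -- plays this role.
  have hcab : circuit K a b ∈ J := hother a b hab
    (not_associated_of_eval (eval_circuit_of_ne hA hac hbc)
      (by rw [eval_circuit_right hA hac]; simp))
  have hccb : circuit K c b ∈ J := hother c b hbc.symm fun h =>
    not_associated_of_eval (eval_circuit_of_ne hA hab hbc.symm)
      (by rw [eval_circuit_right hA hbc.symm]; simp) h.symm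
  obtain ⟨k, l, f, hf, d, hd, hfd, heq⟩ := circuit_eq_combination (K := K) hA a b c h1 h2
  have hfJ : f ∈ J := mem_span_diff_of_lt hhom (hspan ▸ hf) hg hfd hgd hd
  have hcac : circuit K a c ∈ J := by
    rw [heq]
    exact J.sub_mem (J.add_mem (J.mul_mem_left _ hcab) (J.mul_mem_left _ hfJ))
      (J.mul_mem_left _ hccb)
  have hgJ : g ∈ J := by
    obtain ⟨u, hu⟩ := hgass.symm
    rw [← hu]
    exact J.mul_mem_right _ hcac
  have hJI : J = toricIdeal K A := by
    rw [← hspan]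
    refine le_antisymm (Ideal.span_mono Set.sdiff_subset) (Ideal.span_le.mpr fun h hh => ?_)
    by_cases hhg : h = g
    · exact hhg ▸ hgJ
    · exact Ideal.subset_span ⟨hh, hhg⟩
  exact (hmin.le_of_le hJI Set.sdiff_subset hg).2 rfl

/-- The pair with the largest lcm takes the role of `a`, `c` above; ties are harmless. -/
lemma not_isRobustIdeal_of_three [Finite A] (hA : 0 ∉ A) {a b c : A} (hab : a ≠ b)
    (hac : a ≠ c) (hbc : b ≠ c) : ¬ IsRobustIdeal (toricIdeal K A) := by
  have hs1 := Nat.lcm_comm (a : ℕ) b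
  have hs2 := Nat.lcm_comm (a : ℕ) c
  have hs3 := Nat.lcm_comm (b : ℕ) c
  rcases le_total (Nat.lcm a b) (Nat.lcm a c) with h1 | h1
  · rcases le_total (Nat.lcm b c) (Nat.lcm a c) with h2 | h2
    · exact not_isRobustIdeal_of_lcm_le hA hab hac hbc h1 (by omega)
    · exact not_isRobustIdeal_of_lcm_le hA hab.symm hbc hac (by omega) (by omega)
  · rcases le_total (Nat.lcm b c) (Nat.lcm a b) with h2 | h2
    · exact not_isRobustIdeal_of_lcm_le hA hac hab hbc.symm h1 (by omega)
    · exact not_isRobustIdeal_of_lcm_le hA hab.symm hbc hac (by omega) (by omega)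

end toricIdeal

theorem corollary4p17 (K : Type*) [Field K] (S : AddSubmonoid ℕ)
    (hS : IsNumericalSemigroup S) (hS' : S ≠ ⊤)
    (A : Set ℕ) (hA : IsMinimalGeneratingSet S A) :
    (IsRobustIdeal (toricIdeal K A) ↔ A.ncard = 2) ∧
    (A.ncard = 2 ↔ Submodule.IsPrincipal (toricIdeal K A)) := by
  have hfin : Finite A := hA.finite
  have h0 := hA.zero_notMem
  have hle := hA.two_le_ncard hS hS'
  have hpair : A.ncard = 2 → ∃ i j : A, i ≠ j ∧ ∀ k : A, k = i ∨ k = j := by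
    intro h
    obtain ⟨i, j, hij, rfl⟩ := Set.ncard_eq_two.mp h
    refine ⟨⟨i, by simp⟩, ⟨j, by simp⟩, by simpa using hij, fun k => ?_⟩
    rcases k.2 with hk | hk
    · exact Or.inl (Subtype.ext hk)
    · exact Or.inr (Subtype.ext hk)
  have hthree : A.ncard ≠ 2 → ∃ a b c : A, a ≠ b ∧ a ≠ c ∧ b ≠ c := by
    intro h
    obtain ⟨a, b, c, ha, hb, hc, hab, hac, hbc⟩ :=
      (Set.two_lt_ncard_iff hA.finite).mp (show 2 < A.ncard by omega)
    exact ⟨⟨a, ha⟩, ⟨b, hb⟩, ⟨c, hc⟩, by simpa using hab, by simpa using hac, by simpa using hbc⟩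
  refine ⟨⟨fun hrob => ?_, fun h => ?_⟩, ⟨fun h => ?_, fun hprin => ?_⟩⟩
  · by_contra h
    obtain ⟨a, b, c, hab, hac, hbc⟩ := hthree h
    exact toricIdeal.not_isRobustIdeal_of_three h0 hab hac hbc hrob
  · obtain ⟨i, j, hij, hall⟩ := hpair h
    exact toricIdeal.isRobustIdeal_of_pair h0 hij hall
  · obtain ⟨i, j, hij, hall⟩ := hpair h
    exact ⟨_, toricIdeal.eq_span_circuit h0 hij hall⟩
  · by_contra h
    obtain ⟨a, b, c, hab, hac, hbc⟩ := hthree h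
    exact toricIdeal.not_isPrincipal_of_three h0 hab hac hbc hprin
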